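/- Let $(S,\Sigma,P)$ be an adequate probability space: either $P$ is nonatomic on $\Sigma$ (every event $A$ with $P(A)>0$ contains an event $B$ with $0<P(B)<P(A)$), or $\Sigma$ is generated by a finite partition of $S$ all of whose cells have the same probability (the finite uniform case). For $p\in(0,\infty)$ let $L^p$ be the space of (real) random variables on $S$ with finite absolute $p$-th moment, up to almost sure equality; let $L^0$ be the space of all random variables, $L^\infty$ that of the essentially bounded ones, and $M^\infty=\bigcap_{p\in\mathbb N}L^p$. Write $\overset{d}{=}$ for equality in law, and $\ell_f,u_f$ for the essential infimum and supremum of $f$. Let $k\ge 1$ be a real number and $f\in L^k$. Then $\mathbb E[f]=0$ if and only if there exist $g,g'\in L^{k-1}$ such that $g\overset{d}{=}g'$ and $g-g'\overset{d}{=}f$. Likewise, if $f\in L^\infty$ (respectively $f\in M^\infty$), then $\mathbb E[f]=0$ if and only if there exist $g,g'\in L^\infty$ (respectively $g,g'\in M^\infty$) such that $g\overset{d}{=}g'$ and $g-g'\overset{d}{=}f$. Moreover, suppose $\mathbb E[f]=0$. (i) If $f\in L^\infty$, there are $g,g'\in L^\infty$ with $g\overset{d}{=}g'$, $g-g'\overset{d}{=}f$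 and $\ell_f\le g,g'\le u_f$ almost surely. (ii) If $f\in M^\infty$, there are $g,g'\in M^\infty$ with $g\overset{d}{=}g'$ and $g-g'\overset{d}{=}f$. (iii) In the finite uniform case, there are $g,g'\in L^\infty$ with $g\overset{d}{=}g'$, $g-g'=f$ and $\ell_f\le g,g'\le u_f$. -/

import Mathlib

open MeasureTheory ProbabilityTheory
open scoped ENNReal

/-- `P` is nonatomic on its sigma-algebra: every event of positive probability contains an event of
strictly smaller positive probability. -/
def IsNonatomic {S : Type*} [MeasurableSpace S] (P : Measure S) : Prop :=
  ∀ A : Set S, MeasurableSet A → 0 < P A →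
    ∃ B : Set S, B ⊆ A ∧ MeasurableSet B ∧ 0 < P B ∧ P B < P A

/-- The sigma-algebra is generated by a finite partition of `S` (into nonempty cells) and all
cells have the same probability. -/
def IsFiniteUniform {S : Type*} [mS : MeasurableSpace S] (P : Measure S) : Prop :=
  ∃ π : Set (Set S), π.Finite ∧ Setoid.IsPartition π ∧
    mS = MeasurableSpace.generateFrom π ∧ ∀ E ∈ π, P E = (π.ncard : ℝ≥0∞)⁻¹

/-- Adequate measures: nonatomic, or uniform on a finite partition generating the sigma-algebra. -/
def IsAdequate {S : Type*} [MeasurableSpace S] (P : Measure S) : Prop :=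
  IsNonatomic P ∨ IsFiniteUniform P

/-- The random variables `f : S → ℝ` in `L^p`, `0 ≤ p ≤ ∞` (all random variables for `p = 0`,
finite absolute `p`-th moment for `0 < p < ∞`, essentially bounded for `p = ∞`). -/
def randomLp {S : Type*} [MeasurableSpace S] (p : ℝ≥0∞) (P : Measure S) : Set (S → ℝ) :=
  {f | Measurable f ∧ MemLp f p P}

/-- The space `M^∞` of random variables with finite absolute moments of all orders. -/
def randomMInf {S : Type*} [MeasurableSpace S] (P : Measure S) : Set (S → ℝ) :=
  ⋂ p : ℕ, randomLp (p : ℝ≥0∞) P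

/-! If `g` and `g'` share a law and `g - g'` is integrable, then `g - g'` has mean zero even when
`g` is not integrable: truncations of `g` and `g'` have equal means, and dominated convergence
removes the truncation (`IdentDistrib.integral_sub_eq_zero`).

Conversely, let `μ` be the centred law of `f`. For `y < 0 ≤ x`, rotate the circle `[y, x)` by `-x`,
which is the same as by `-y`. This preserves Lebesgue measure, and `t - rotate (x, y, t)` equals `x`
on an arc of length `-y` and `y` on an arc of length `x`. Averaging over `μ ⊗ μ`, the equality of
the means of the positive and negative parts turns the law of the difference into `μ`
(`map_sub_rotate_rotationLaw`). The arc length `x - y` in the density is what costs one moment. A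
nonatomic space carries every law on a standard Borel space, hence this one.

In the finite uniform case, the values of `f` are ordered greedily so that partial sums stay within
its bounds. Consecutive partial sums give the pair: they run through the same closed cycle, shifted
by one step. -/

/-! ### Nonatomic spaces carry every standard Borel law -/

theorem IsNonatomic.exists_subset_small {S : Type*} [MeasurableSpace S] {P : Measure S}
    [IsProbabilityMeasure P] (hP : IsNonatomic P) {A : Set S} (hA : MeasurableSet A)
    (hA0 : 0 < P A) (n : ℕ) :
    ∃ B ⊆ A, MeasurableSet B ∧ 0 < P B ∧ P B ≤ (2⁻¹ : ℝ≥0∞) ^ n := by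
  induction n with
  | zero => exact ⟨A, subset_rfl, hA, hA0, by simpa using prob_le_one⟩
  | succ n ih =>
    obtain ⟨B, hBA, hB, hB0, hBn⟩ := ih
    obtain ⟨C, hCB, hC, hC0, hCB'⟩ := hP B hB hB0
    have hsum : P C + P (B \ C) = P B := by
      rw [← measure_inter_add_sdiff B hC, Set.inter_eq_self_of_subset_right hCB]
    have hhalf : P B / 2 ≤ (2⁻¹ : ℝ≥0∞) ^ (n + 1) := by
      rw [pow_succ, ENNReal.div_eq_inv_mul, mul_comm]
      gcongr
    rcases le_total (P C) (P B / 2) with h | h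
    · exact ⟨C, hCB.trans hBA, hC, hC0, h.trans hhalf⟩
    · refine ⟨B \ C, Set.sdiff_subset.trans hBA, hB.diff hC, ?_, ?_⟩
      · rw [pos_iff_ne_zero]
        intro h0
        rw [h0, add_zero] at hsum
        exact hCB'.ne hsum
      · refine le_trans ?_ hhalf
        by_contra! h'
        have hlt : P B / 2 + P B / 2 < P C + P (B \ C) :=
          ENNReal.add_lt_add_of_le_of_lt (ENNReal.div_lt_top (measure_ne_top _ _) (by simp)).ne
            h h'
        rw [ENNReal.add_halves, hsum] at hlt
        exact hlt.false

/-- A maximal disjoint family of small sets of positive measure is countable; if it left out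
positive mass, one more small set would fit there. -/
theorem IsNonatomic.exists_countable_small_cover {S : Type*} [MeasurableSpace S] {P : Measure S}
    [IsProbabilityMeasure P] (hP : IsNonatomic P) (n : ℕ) :
    ∃ F : Set (Set S), F.Countable ∧ (∀ A ∈ F, MeasurableSet A ∧ P A ≤ (2⁻¹ : ℝ≥0∞) ^ n) ∧
      P (⋃₀ F)ᶜ = 0 := by
  let good : Set (Set (Set S)) := {F | (F.PairwiseDisjoint id) ∧
    ∀ A ∈ F, MeasurableSet A ∧ 0 < P A ∧ P A ≤ (2⁻¹ : ℝ≥0∞) ^ n}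
  obtain ⟨F, hF⟩ : ∃ F, Maximal (· ∈ good) F := by
    refine zorn_subset good fun c hc hchain => ⟨⋃₀ c, ⟨?_, ?_⟩, fun s hs => Set.subset_sUnion_of_mem hs⟩
    · rw [Set.pairwiseDisjoint_sUnion hchain.directedOn]
      exact fun a ha => (hc ha).1
    · rintro A ⟨G, hG, hAG⟩
      exact (hc hG).2 A hAG
  have hcount : F.Countable := by
    have h := Measure.countable_meas_pos_of_disjoint_iUnion (μ := P) (As := fun i : F => (i : Set S))
      (fun i => (hF.prop.2 i i.2).1)
      (fun i j hij => hF.prop.1 i.2 j.2 (fun h => hij (Subtype.ext h)))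
    have huniv : {i : F | 0 < P (i : Set S)} = Set.univ :=
      Set.eq_univ_of_forall fun i => (hF.prop.2 i i.2).2.1
    rw [huniv, Set.countable_univ_iff] at h
    exact h
  refine ⟨F, hcount, fun A hA => ⟨(hF.prop.2 A hA).1, (hF.prop.2 A hA).2.2⟩, ?_⟩
  by_contra h0
  have hmeas : MeasurableSet (⋃₀ F)ᶜ :=
    (MeasurableSet.sUnion hcount fun A hA => (hF.prop.2 A hA).1).compl
  obtain ⟨B, hBsub, hB, hB0, hBn⟩ := hP.exists_subset_small hmeas (pos_iff_ne_zero.2 h0) n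
  have hdisj : ∀ A ∈ F, Disjoint B A := fun A hA =>
    Set.disjoint_of_subset_right (Set.subset_sUnion_of_mem hA)
      (Set.disjoint_left.2 fun s hs => hBsub hs)
  have hins : insert B F ∈ good := by
    refine ⟨hF.prop.1.insert fun A hA _ => hdisj A hA, ?_⟩
    rintro A (rfl | hA)
    · exact ⟨hB, hB0, hBn⟩
    · exact hF.prop.2 A hA
  have hBF : B ∈ F := hF.le_of_ge hins (Set.subset_insert B F) (Set.mem_insert B F)
  have := hdisj B hBF
  rw [disjoint_self] at this
  simp [this] at hB0

/-- The indicators of all sets in the covers are coded into one real number. A fibre that meets the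
covered points lies, for every `n`, inside a single set of `F n`, so its measure is at most `2⁻¹ ^
n`. -/
theorem IsNonatomic.exists_measurable_noAtoms_map {S : Type*} [MeasurableSpace S] {P : Measure S}
    [IsProbabilityMeasure P] (hP : IsNonatomic P) :
    ∃ φ : S → ℝ, Measurable φ ∧ ∀ x, P.map φ {x} = 0 := by
  choose F hFc hF hFnull using hP.exists_countable_small_cover
  let G : Set (Set S) := ⋃ n, F n
  have hGc : Countable G := (Set.countable_iUnion hFc).to_subtype
  have hG : ∀ A : G, MeasurableSet (A : Set S) := by
    rintro ⟨A, hA⟩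
    obtain ⟨n, hn⟩ := Set.mem_iUnion.1 hA
    exact (hF n A hn).1
  let Φ : S → (G → ℝ) := fun s A => (A : Set S).indicator 1 s
  have hΦ : Measurable Φ := measurable_pi_lambda _ fun A => measurable_one.indicator (hG A)
  have hemb := measurableEmbedding_embeddingReal (G → ℝ)
  have hm : Measurable fun s => embeddingReal (G → ℝ) (Φ s) := hemb.measurable.comp hΦ
  refine ⟨_, hm, fun x => ?_⟩
  rw [Measure.map_apply hm (measurableSet_singleton x)]
  set E : Set S := (fun s => embeddingReal (G → ℝ) (Φ s)) ⁻¹' {x} with hE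
  by_contra h0
  have hnull : P (⋃ n, (⋃₀ F n)ᶜ) = 0 := measure_iUnion_null hFnull
  obtain ⟨s, hsE, hs⟩ : (E \ ⋃ n, (⋃₀ F n)ᶜ).Nonempty := by
    apply nonempty_of_measure_ne_zero (μ := P)
    rwa [measure_sdiff_null hnull]
  simp only [Set.mem_iUnion, Set.mem_compl_iff, not_exists, not_not] at hs
  have hle : ∀ n : ℕ, P E ≤ (2⁻¹ : ℝ≥0∞) ^ n := by
    intro n
    obtain ⟨A, hAF, hsA⟩ := hs n
    refine (measure_mono fun r hr => ?_).trans (hF n A hAF).2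
    have hrs : Φ r = Φ s := hemb.injective (Eq.trans hr (Eq.symm hsE))
    have := congrFun hrs ⟨A, Set.mem_iUnion.2 ⟨n, hAF⟩⟩
    by_contra hrA
    simp [Φ, hsA, hrA] at this
  have hlim := ENNReal.tendsto_pow_atTop_nhds_zero_of_lt_one (r := 2⁻¹) (by simp)
  exact h0 (le_antisymm (ge_of_tendsto' hlim hle) zero_le)

/-- Probability integral transform: without atoms the cdf is continuous, so a nonempty sublevel set
for `u < 1` is a closed half-line at whose endpoint the cdf equals `u`. -/
theorem measure_setOf_cdf_le {μ : Measure ℝ} [IsProbabilityMeasure μ] (hμ : ∀ x, μ {x} = 0)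
    {u : ℝ} (hu0 : 0 ≤ u) (hu1 : u ≤ 1) : μ {x | cdf μ x ≤ u} = ENNReal.ofReal u := by
  rcases hu1.eq_or_lt with rfl | hu1
  · simp [cdf_le_one]
  have hcont : Continuous (cdf μ) := by
    rw [continuous_iff_continuousAt]
    intro x
    rw [(monotone_cdf μ).continuousAt_iff_leftLim_eq_rightLim, StieltjesFunction.rightLim_eq]
    have h := StieltjesFunction.measure_singleton (cdf μ) x
    rw [measure_cdf, hμ, eq_comm, ENNReal.ofReal_eq_zero] at h
    exact le_antisymm ((monotone_cdf μ).leftLim_le le_rfl) (by linarith)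
  set E : Set ℝ := {x | cdf μ x ≤ u} with hE
  have hEclosed : IsClosed E := isClosed_le hcont continuous_const
  have hbdd : BddAbove E := by
    obtain ⟨b, hb⟩ := ((tendsto_cdf_atTop μ).eventually (lt_mem_nhds hu1)).exists
    refine ⟨b, fun x hx => ?_⟩
    by_contra! hbx
    exact absurd (monotone_cdf μ hbx.le) (not_le.2 (lt_of_le_of_lt hx hb))
  rcases E.eq_empty_or_nonempty with hEe | hne
  · have h0 : u = 0 := by
      refine le_antisymm ?_ hu0
      refine ge_of_tendsto' (tendsto_cdf_atBot μ) fun x => ?_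
      by_contra! h
      have : x ∈ E := h.le
      simp [hEe] at this
    simp [hEe, h0]
  have hmem : sSup E ∈ E := hEclosed.csSup_mem hne hbdd
  have hEIic : E = Set.Iic (sSup E) := by
    ext x
    exact ⟨fun hx => le_csSup hbdd hx, fun hx => (monotone_cdf μ hx).trans hmem⟩
  have hval : cdf μ (sSup E) = u := by
    refine le_antisymm hmem ?_
    by_contra! hlt
    obtain ⟨y, hy, hy'⟩ :=
      ((hcont.continuousAt.eventually (gt_mem_nhds hlt)).filter_mono
        (nhdsWithin_le_nhds (s := Set.Ioi (sSup E)))).and self_mem_nhdsWithin |>.exists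
    exact absurd (le_csSup hbdd (show y ∈ E from hy.le)) (not_le.2 hy')
  rw [hEIic, ← ofReal_cdf, hval]

/-- The atomless variable composed with its cdf is uniform on the unit interval, from which any law
`Q` is a measurable image. -/
theorem IsNonatomic.exists_measurable_map_eq {S : Type*} [MeasurableSpace S] {P : Measure S}
    [IsProbabilityMeasure P] (hP : IsNonatomic P) {Y : Type*} [Nonempty Y] [MeasurableSpace Y]
    [StandardBorelSpace Y] (Q : Measure Y) [IsProbabilityMeasure Q] :
    ∃ V : S → Y, Measurable V ∧ P.map V = Q := by
  obtain ⟨φ, hφ, hatom⟩ := hP.exists_measurable_noAtoms_map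
  have : IsProbabilityMeasure (P.map φ) := Measure.isProbabilityMeasure_map hφ.aemeasurable
  obtain ⟨h, hh, hhQ⟩ := Measure.exists_measurable_map_eq Q
  let U : S → unitInterval := fun s =>
    ⟨cdf (P.map φ) (φ s), cdf_nonneg _ _, cdf_le_one _ _⟩
  have hF : Measurable (cdf (P.map φ)) := (monotone_cdf _).measurable
  have hU : Measurable U := (hF.comp hφ).subtype_mk
  have : IsProbabilityMeasure (P.map U) := Measure.isProbabilityMeasure_map hU.aemeasurable
  have hUlaw : P.map U = volume := by
    refine Measure.ext_of_Iic _ _ fun u => ?_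
    rw [Measure.map_apply hU measurableSet_Iic, unitInterval.volume_Iic,
      ← measure_setOf_cdf_le hatom u.2.1 u.2.2,
      Measure.map_apply hφ (measurableSet_le hF measurable_const)]
    rfl
  exact ⟨h ∘ U, hh.comp hU, by rw [← Measure.map_map hh hU, hUlaw, hhQ]⟩

/-! ### The rotation construction on nonatomic spaces -/

/-- For `y ≤ t < x`, the image of `t` under the rotation by `-x` of the circle `[y, x)` of
length `x - y`. -/
noncomputable def rotate (z : ℝ × ℝ × ℝ) : ℝ :=
  if z.1 + z.2.1 ≤ z.2.2 then z.2.2 - z.1 else z.2.2 - z.2.1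

theorem measurable_rotate : Measurable rotate :=
  Measurable.ite (measurableSet_le (by fun_prop) (by fun_prop)) (by fun_prop) (by fun_prop)

/-- The law of a triple `(x, y, t)`, where `x ≥ 0 > y` are drawn with density proportional to
`(x - y) μ(dx) μ(dy)` and `t` is uniform on `[y, x)`. -/
noncomputable def rotationLaw (μ : Measure ℝ) : Measure (ℝ × ℝ × ℝ) :=
  (∫⁻ x in Set.Ici 0, ENNReal.ofReal x ∂μ)⁻¹ •
    ((μ.restrict (Set.Ici 0)).prod ((μ.restrict (Set.Iio 0)).prod volume)).restrict
      {z | z.2.1 ≤ z.2.2 ∧ z.2.2 < z.1}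

theorem measurableSet_rotationDomain :
    MeasurableSet {z : ℝ × ℝ × ℝ | z.2.1 ≤ z.2.2 ∧ z.2.2 < z.1} :=
  (measurableSet_le (f := fun z : ℝ × ℝ × ℝ => z.2.1) (g := fun z => z.2.2)
    (by fun_prop) (by fun_prop)).inter
    (measurableSet_lt (f := fun z : ℝ × ℝ × ℝ => z.2.2) (g := fun z => z.1)
      (by fun_prop) (by fun_prop))

theorem lintegral_rotationLaw (μ : Measure ℝ) [IsProbabilityMeasure μ] {F : ℝ × ℝ × ℝ → ℝ≥0∞}
    (hF : Measurable F) :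
    ∫⁻ z, F z ∂rotationLaw μ = (∫⁻ x in Set.Ici 0, ENNReal.ofReal x ∂μ)⁻¹ *
      ∫⁻ x in Set.Ici 0, ∫⁻ y in Set.Iio 0, (∫⁻ t in Set.Ico y x, F (x, y, t)) ∂μ ∂μ := by
  rw [rotationLaw, lintegral_smul_measure, smul_eq_mul,
    ← lintegral_indicator measurableSet_rotationDomain,
    lintegral_prod _ (hF.indicator measurableSet_rotationDomain).aemeasurable]
  congr 1
  refine lintegral_congr fun x => ?_
  have hx : Measurable fun w : ℝ × ℝ =>
      {z : ℝ × ℝ × ℝ | z.2.1 ≤ z.2.2 ∧ z.2.2 < z.1}.indicator F (x, w) :=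
    (hF.indicator measurableSet_rotationDomain).comp (measurable_const.prodMk measurable_id)
  rw [lintegral_prod _ hx.aemeasurable]
  refine lintegral_congr fun y => ?_
  rw [← lintegral_indicator measurableSet_Ico]
  rfl

/-- The rotation translates `[y, x + y)` onto `[0, x)` and `[x + y, x)` onto `[y, 0)`. -/
theorem setLIntegral_Ico_rotate {x y : ℝ} (hx : 0 ≤ x) (hy : y < 0) (h : ℝ → ℝ≥0∞) :
    ∫⁻ t in Set.Ico y x, h (rotate (x, y, t)) = ∫⁻ t in Set.Ico y x, h t := by
  have shift (a b c : ℝ) :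
      ∫⁻ t in Set.Ico a b, h (t - c) = ∫⁻ t in Set.Ico (a - c) (b - c), h t := by
    have hp := (measurePreserving_sub_right (volume : Measure ℝ) c).setLIntegral_comp_preimage_emb
      (measurableEmbedding_subRight c) h (Set.Ico (a - c) (b - c))
    rwa [Set.preimage_sub_const_Ico, sub_add_cancel, sub_add_cancel] at hp
  have split (a b c : ℝ) (hab : a ≤ b) (hbc : b ≤ c) (k : ℝ → ℝ≥0∞) :
      ∫⁻ t in Set.Ico a c, k t = (∫⁻ t in Set.Ico a b, k t) + ∫⁻ t in Set.Ico b c, k t := by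
    rw [← Set.Ico_union_Ico_eq_Ico hab hbc, lintegral_union measurableSet_Ico]
    exact Set.Ico_disjoint_Ico_same
  rw [split y (x + y) x (by linarith) (by linarith), split y 0 x hy.le hx,
    add_comm (∫⁻ t in Set.Ico y (x + y), _)]
  congr 1
  · rw [setLIntegral_congr_fun (g := fun t => h (t - x)) measurableSet_Ico, shift]
    · congr 3 <;> ring
    · intro t ht
      simp only [rotate]
      rw [if_pos ht.1]
  · rw [setLIntegral_congr_fun (g := fun t => h (t - y)) measurableSet_Ico, shift]
    · congr 3 <;> ring
    · intro t ht
      simp only [rotate]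
      rw [if_neg (not_le.2 ht.2)]

theorem setLIntegral_Ico_sub_rotate {x y : ℝ} (hx : 0 ≤ x) (hy : y < 0) (h : ℝ → ℝ≥0∞) :
    ∫⁻ t in Set.Ico y x, h (t - rotate (x, y, t)) =
      h x * ENNReal.ofReal (-y) + ENNReal.ofReal x * h y := by
  rw [← Set.Ico_union_Ico_eq_Ico (b := x + y) (by linarith) (by linarith),
    lintegral_union measurableSet_Ico Set.Ico_disjoint_Ico_same, add_comm]
  congr 1
  · rw [setLIntegral_congr_fun (g := fun _ => h x) measurableSet_Ico, setLIntegral_const,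
      Real.volume_Ico]
    · congr 2; ring
    · intro t ht
      simp only [rotate]
      rw [if_pos ht.1, sub_sub_cancel]
  · rw [setLIntegral_congr_fun (g := fun _ => h y) measurableSet_Ico, setLIntegral_const,
      Real.volume_Ico, mul_comm]
    · congr 2; ring
    · intro t ht
      simp only [rotate]
      rw [if_neg (not_le.2 ht.2), sub_sub_cancel]

theorem map_rotate_rotationLaw (μ : Measure ℝ) [IsProbabilityMeasure μ] :
    (rotationLaw μ).map rotate = (rotationLaw μ).map (fun z => z.2.2) := by
  refine Measure.ext_of_lintegral _ fun h hh => ?_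
  rw [lintegral_map hh measurable_rotate, lintegral_map hh (by fun_prop),
    lintegral_rotationLaw μ (F := fun z => h (rotate z)) (hh.comp measurable_rotate), lintegral_rotationLaw μ (by fun_prop)]
  congr 1
  refine setLIntegral_congr_fun measurableSet_Ici fun x hx => ?_
  exact setLIntegral_congr_fun measurableSet_Iio fun y hy => setLIntegral_Ico_rotate hx hy h

theorem lintegral_Ici_eq_lintegral_Iio_neg {μ : Measure ℝ} (hint : Integrable id μ)
    (hmean : ∫ x, x ∂μ = 0) :
    ∫⁻ x in Set.Ici 0, ENNReal.ofReal x ∂μ = ∫⁻ x in Set.Iio 0, ENNReal.ofReal (-x) ∂μ := by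
  have h1 : ∫⁻ x in Set.Ici 0, ENNReal.ofReal x ∂μ = ∫⁻ x, ENNReal.ofReal x ∂μ := by
    refine setLIntegral_eq_of_support_subset fun x hx => ?_
    by_contra hx0
    exact hx (ENNReal.ofReal_eq_zero.2 (not_le.1 hx0).le)
  have h2 : ∫⁻ x in Set.Iio 0, ENNReal.ofReal (-x) ∂μ = ∫⁻ x, ENNReal.ofReal (-x) ∂μ := by
    refine setLIntegral_eq_of_support_subset fun x hx => ?_
    by_contra hx0
    exact hx (ENNReal.ofReal_eq_zero.2 (by linarith [Set.notMem_Iio.1 hx0]))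
  have h3 := integral_eq_lintegral_pos_part_sub_lintegral_neg_part hint
  have hp : ∫⁻ x, ENNReal.ofReal x ∂μ ≠ ∞ := hint.lintegral_lt_top.ne
  have hn : ∫⁻ x, ENNReal.ofReal (-x) ∂μ ≠ ∞ := hint.neg.lintegral_lt_top.ne
  simp only [id] at h3
  rw [hmean, eq_comm, sub_eq_zero, ENNReal.toReal_eq_toReal_iff' hp hn] at h3
  rw [h1, h2, h3]

theorem map_sub_rotate_rotationLaw {μ : Measure ℝ} [IsProbabilityMeasure μ]
    (hint : Integrable id μ) (hmean : ∫ x, x ∂μ = 0)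
    (hc : ∫⁻ x in Set.Ici 0, ENNReal.ofReal x ∂μ ≠ 0) :
    (rotationLaw μ).map (fun z => z.2.2 - rotate z) = μ := by
  have hm : Measurable fun z : ℝ × ℝ × ℝ => z.2.2 - rotate z :=
    Measurable.sub (by fun_prop) measurable_rotate
  refine Measure.ext_of_lintegral _ fun h hh => ?_
  rw [lintegral_map hh hm, lintegral_rotationLaw μ (F := fun z => h (z.2.2 - rotate z)) (hh.comp hm)]
  have hfin : ∫⁻ x in Set.Ici 0, ENNReal.ofReal x ∂μ ≠ ∞ :=
    ((setLIntegral_le_lintegral _ _).trans_lt hint.lintegral_lt_top).ne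
  have hneg := lintegral_Ici_eq_lintegral_Iio_neg hint hmean
  set c := ∫⁻ x in Set.Ici 0, ENNReal.ofReal x ∂μ with hcdef
  have hinner : ∫⁻ x in Set.Ici 0, ∫⁻ y in Set.Iio 0, (∫⁻ t in Set.Ico y x,
      h (t - rotate (x, y, t))) ∂μ ∂μ = c * ∫⁻ x, h x ∂μ := by
    calc _ = ∫⁻ x in Set.Ici 0, (h x * c + ENNReal.ofReal x * ∫⁻ y in Set.Iio 0, h y ∂μ) ∂μ := by
          refine setLIntegral_congr_fun measurableSet_Ici fun x hx => ?_
          rw [setLIntegral_congr_fun measurableSet_Iio fun y hy =>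
            setLIntegral_Ico_sub_rotate hx hy h, lintegral_add_left (by fun_prop),
            lintegral_const_mul _ (by fun_prop), lintegral_const_mul _ hh, hneg]
      -- Both terms carry the same factor `c`, by centredness, so the two half-lines recombine into
      -- the whole integral.
      _ = c * ∫⁻ x, h x ∂μ := by
          rw [lintegral_add_left (by fun_prop), lintegral_mul_const _ hh,
            lintegral_mul_const _ (by fun_prop), ← hcdef, ← lintegral_add_compl (μ := μ) h
            (measurableSet_Ici (a := (0 : ℝ))), Set.compl_Ici]
          ring
  rw [hinner, ← mul_assoc, ENNReal.inv_mul_cancel hc hfin, one_mul]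

theorem isProbabilityMeasure_rotationLaw {μ : Measure ℝ} [IsProbabilityMeasure μ]
    (hint : Integrable id μ) (hmean : ∫ x, x ∂μ = 0)
    (hc : ∫⁻ x in Set.Ici 0, ENNReal.ofReal x ∂μ ≠ 0) :
    IsProbabilityMeasure (rotationLaw μ) := by
  have hm : Measurable fun z : ℝ × ℝ × ℝ => z.2.2 - rotate z :=
    Measurable.sub (by fun_prop) measurable_rotate
  constructor
  have h := Measure.map_apply hm MeasurableSet.univ (μ := rotationLaw μ)
  rw [map_sub_rotate_rotationLaw hint hmean hc, measure_univ, Set.preimage_univ] at h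
  exact h.symm

/-- Almost surely `x` and `y` obey the bounds, and `t` lies between them. -/
theorem ae_rotationLaw_mem_Icc {μ : Measure ℝ} [IsProbabilityMeasure μ] {l u : ℝ}
    (h : ∀ᵐ x ∂μ, l ≤ x ∧ x ≤ u) : ∀ᵐ z ∂rotationLaw μ, l ≤ z.2.2 ∧ z.2.2 ≤ u := by
  refine Measure.ae_smul_measure ?_ _
  rw [ae_restrict_iff' measurableSet_rotationDomain]
  have h1 := Measure.quasiMeasurePreserving_fst (μ := μ.restrict (Set.Ici 0))
    (ν := (μ.restrict (Set.Iio 0)).prod (volume : Measure ℝ)) |>.ae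
      (ae_restrict_of_ae (s := Set.Ici 0) h)
  have h2 := (Measure.quasiMeasurePreserving_fst (μ := μ.restrict (Set.Iio 0))
    (ν := (volume : Measure ℝ)) |>.comp (Measure.quasiMeasurePreserving_snd
      (μ := μ.restrict (Set.Ici 0)))).ae (ae_restrict_of_ae (s := Set.Iio 0) h)
  filter_upwards [h1, h2] with z hz1 hz2 hz
  exact ⟨hz2.1.trans hz.1, hz.2.le.trans hz1.2⟩

theorem memLp_rotationLaw {μ : Measure ℝ} [IsProbabilityMeasure μ]
    (hc : ∫⁻ x in Set.Ici 0, ENNReal.ofReal x ∂μ ≠ 0) {k : ℝ} (hk : 1 ≤ k)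
    (h : MemLp id (ENNReal.ofReal k) μ) :
    MemLp (fun z : ℝ × ℝ × ℝ => z.2.2) (ENNReal.ofReal (k - 1)) (rotationLaw μ) := by
  have hm : Measurable fun z : ℝ × ℝ × ℝ => z.2.2 := by fun_prop
  rcases hk.eq_or_lt with rfl | hk
  -- For `k = 1` the target exponent is `0`, where only measurability is required.
  · simpa using hm.aestronglyMeasurable
  have hk1 : 0 < k - 1 := by linarith
  refine ⟨hm.aestronglyMeasurable, ?_⟩
  rw [eLpNorm_lt_top_iff_lintegral_rpow_enorm_lt_top (by simpa using hk1) (by simp),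
    ENNReal.toReal_ofReal hk1.le, lintegral_rotationLaw μ (by fun_prop)]
  refine ENNReal.mul_lt_top (by simpa using pos_iff_ne_zero.2 hc) ?_
  have hdiff : MemLp (fun p : ℝ × ℝ => p.1 - p.2) (ENNReal.ofReal k) (μ.prod μ) :=
    (h.comp_fst μ).sub (h.comp_snd μ)
  have hlt := (eLpNorm_lt_top_iff_lintegral_rpow_enorm_lt_top (by simp; linarith) (by simp)).1
    hdiff.2
  rw [ENNReal.toReal_ofReal (by linarith), lintegral_prod _ (by fun_prop)] at hlt
  refine lt_of_le_of_lt ?_ hlt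
  refine (setLIntegral_mono' measurableSet_Ici fun x hx => ?_).trans
    (setLIntegral_le_lintegral _ _)
  refine (setLIntegral_mono' measurableSet_Iio fun y hy => ?_).trans
    (setLIntegral_le_lintegral _ _)
  simp only [Set.mem_Ici, Set.mem_Iio] at hx hy
  -- Since `y < 0 ≤ x`, `|t| ≤ x - y` on the interval, whose length supplies the missing power of `x
  -- - y`.
  calc ∫⁻ t in Set.Ico y x, ‖t‖ₑ ^ (k - 1)
      ≤ ∫⁻ _ in Set.Ico y x, ‖x - y‖ₑ ^ (k - 1) := by
        refine setLIntegral_mono' measurableSet_Ico fun t ht => ?_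
        gcongr
        rw [enorm_le_iff_norm_le, Real.norm_eq_abs, Real.norm_eq_abs, 
          abs_of_pos (by linarith : 0 < x - y), abs_le]
        constructor <;> linarith [ht.1, ht.2]
    _ = ‖x - y‖ₑ ^ k := by
        rw [setLIntegral_const, Real.volume_Ico, ← Real.enorm_of_nonneg (by linarith)]
        nth_rewrite 2 [← ENNReal.rpow_one ‖x - y‖ₑ]
        rw [← ENNReal.rpow_add_of_nonneg _ _ hk1.le zero_le_one, sub_add_cancel]

/-- On a nonatomic probability space, a centred random variable has the law of a difference of
two identically distributed random variables, within the same bounds and with one moment less. -/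
theorem IsNonatomic.exists_identDistrib_sub {S : Type*} [MeasurableSpace S] {P : Measure S}
    [IsProbabilityMeasure P] (hP : IsNonatomic P) {f : S → ℝ} (hf : Measurable f)
    (hint : Integrable f P) (hmean : ∫ s, f s ∂P = 0) :
    ∃ g g' : S → ℝ, Measurable g ∧ Measurable g' ∧ IdentDistrib g g' P P ∧
      IdentDistrib (g - g') f P P ∧
      (∀ k : ℝ, 1 ≤ k → MemLp f (ENNReal.ofReal k) P → MemLp g (ENNReal.ofReal (k - 1)) P) ∧
      ∀ l u : ℝ, (∀ᵐ s ∂P, l ≤ f s ∧ f s ≤ u) → ∀ᵐ s ∂P, l ≤ g s ∧ g s ≤ u := by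
  set μ := P.map f with hμ
  have : IsProbabilityMeasure μ := Measure.isProbabilityMeasure_map hf.aemeasurable
  have hintμ : Integrable id μ :=
    (integrable_map_measure measurable_id.aestronglyMeasurable hf.aemeasurable).2 hint
  have hmeanμ : ∫ x, x ∂μ = 0 := by
    rw [hμ, integral_map (f := fun x => x) hf.aemeasurable measurable_id.aestronglyMeasurable]
    exact hmean
  by_cases hc : ∫⁻ x in Set.Ici 0, ENNReal.ofReal x ∂μ = 0
  -- Here `rotationLaw` cannot be normalized, but `f` vanishes almost surely and the zero pair
  -- works.
  · have hneg := lintegral_Ici_eq_lintegral_Iio_neg hintμ hmeanμ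
    rw [hc, eq_comm, setLIntegral_eq_zero_iff measurableSet_Iio (by fun_prop)] at hneg
    rw [setLIntegral_eq_zero_iff measurableSet_Ici (by fun_prop)] at hc
    have hμ0 : ∀ᵐ x ∂μ, x = 0 := by
      filter_upwards [hneg, hc] with x h1 h2
      rcases lt_or_ge x 0 with hx | hx
      · have := h1 hx
        rw [ENNReal.ofReal_eq_zero] at this
        linarith
      · exact le_antisymm (ENNReal.ofReal_eq_zero.1 (h2 hx)) hx
    have hf0 : ∀ᵐ s ∂P, f s = 0 := ae_of_ae_map hf.aemeasurable hμ0
    refine ⟨0, 0, measurable_zero, measurable_zero, IdentDistrib.refl aemeasurable_zero, ?_,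
      fun k _ _ => MemLp.zero, fun l u h => ?_⟩
    · rw [sub_zero]
      exact IdentDistrib.of_ae_eq aemeasurable_zero (hf0.mono fun s hs => hs.symm)
    · filter_upwards [hf0, h] with s h0 hs
      rwa [h0] at hs
  · have := isProbabilityMeasure_rotationLaw hintμ hmeanμ hc
    obtain ⟨V, hV, hVlaw⟩ := hP.exists_measurable_map_eq (rotationLaw μ)
    have ht : Measurable fun z : ℝ × ℝ × ℝ => z.2.2 := by fun_prop
    refine ⟨fun s => (V s).2.2, fun s => rotate (V s), ht.comp hV, measurable_rotate.comp hV,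
      ⟨(ht.comp hV).aemeasurable, (measurable_rotate.comp hV).aemeasurable, ?_⟩,
      ⟨((ht.comp hV).sub (measurable_rotate.comp hV)).aemeasurable, hf.aemeasurable, ?_⟩,
      fun k hk hfk => ?_, fun l u h => ?_⟩
    · have h := map_rotate_rotationLaw μ
      rw [← hVlaw, Measure.map_map ht hV, Measure.map_map measurable_rotate hV] at h
      exact h.symm
    · have h := map_sub_rotate_rotationLaw hintμ hmeanμ hc
      rw [← hVlaw, Measure.map_map (g := fun z => z.2.2 - rotate z) (ht.sub measurable_rotate) hV] at h
      exact h
    · have h := memLp_rotationLaw hc hk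
        ((memLp_map_measure_iff measurable_id.aestronglyMeasurable hf.aemeasurable).2 hfk)
      rw [← hVlaw] at h
      exact (memLp_map_measure_iff ht.aestronglyMeasurable hV.aemeasurable).1 h
    · have hμlu : ∀ᵐ x ∂μ, l ≤ x ∧ x ≤ u :=
        (ae_map_iff hf.aemeasurable measurableSet_Icc).2 h
      have h' := ae_rotationLaw_mem_Icc hμlu
      rw [← hVlaw] at h'
      exact ae_of_ae_map hV.aemeasurable h'

/-! ### Bounded partial sums and the finite uniform case -/

/-- The greedy step: from `v ≤ 0` some remaining `a i` is nonnegative, and then `v ≤ v + a i ≤ a i`;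
symmetrically for `v > 0`. -/
theorem exists_add_mem_Icc_of_add_sum_eq_zero {ι : Type*} {s : Finset ι} {a : ι → ℝ} {l u v : ℝ}
    (hs : s.Nonempty) (ha : ∀ i ∈ s, a i ∈ Set.Icc l u) (hv : v ∈ Set.Icc l u)
    (hsum : v + ∑ i ∈ s, a i = 0) : ∃ i ∈ s, v + a i ∈ Set.Icc l u := by
  rcases le_or_gt v 0 with h | h
  · obtain ⟨i, hi, hi'⟩ := Finset.exists_le_of_sum_le (f := fun _ => (0 : ℝ)) (g := a) hs
      (by rw [Finset.sum_const_zero]; linarith)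
    exact ⟨i, hi, by linarith [hv.1], by linarith [(ha i hi).2]⟩
  · obtain ⟨i, hi, hi'⟩ := Finset.exists_le_of_sum_le (f := a) (g := fun _ => (0 : ℝ)) hs
      (by rw [Finset.sum_const_zero]; linarith)
    exact ⟨i, hi, by linarith [(ha i hi).1], by linarith [hv.2]⟩

/-- Values in `[l, u]` that bring `v` to zero can be ordered so that all partial sums stay in
`[l, u]`; here `b i` and `b' i` are the partial sums after and before the step `a i`. -/
theorem Finset.exists_partial_sums_mem_Icc {ι : Type*} [DecidableEq ι] (s : Finset ι) {a : ι → ℝ}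
    {l u v : ℝ} (ha : ∀ i ∈ s, a i ∈ Set.Icc l u) (hv : v ∈ Set.Icc l u)
    (hsum : v + ∑ i ∈ s, a i = 0) :
    ∃ b b' : ι → ℝ, (∀ i ∈ s, b i - b' i = a i ∧ b i ∈ Set.Icc l u ∧ b' i ∈ Set.Icc l u) ∧
      v ::ₘ s.val.map b = 0 ::ₘ s.val.map b' := by
  induction hn : s.card generalizing s v with
  | zero =>
    obtain rfl := Finset.card_eq_zero.1 hn
    refine ⟨0, 0, by simp, ?_⟩
    simpa using hsum
  | succ n ih =>
    have hne : s.Nonempty := Finset.card_pos.1 (by omega)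
    obtain ⟨i, hi, hvi⟩ := exists_add_mem_Icc_of_add_sum_eq_zero hne ha hv hsum
    obtain ⟨b, b', hb, hm⟩ := ih (s.erase i) (v := v + a i)
      (fun j hj => ha j (Finset.mem_of_mem_erase hj)) hvi
      (by rw [add_assoc, Finset.add_sum_erase s a hi, hsum])
      (by rw [Finset.card_erase_of_mem hi, hn]; rfl)
    -- The step `a i` is taken first, from `v` to `v + a i`; the recursive path starts at `v + a i`.
    refine ⟨Function.update b i (v + a i), Function.update b' i v, fun j hj => ?_, ?_⟩
    · by_cases hji : j = i
      · subst hji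
        simp only [Function.update_self]
        exact ⟨by ring, hvi, hv⟩
      · simp only [Function.update_of_ne hji]
        exact hb j (Finset.mem_erase.2 ⟨hji, hj⟩)
    · have hmap (c : ι → ℝ) (x : ℝ) :
          s.val.map (Function.update c i x) = x ::ₘ (s.erase i).val.map c := by
        rw [← Finset.insert_erase hi, Finset.insert_val_of_notMem (Finset.notMem_erase i s),
          Multiset.map_cons, Function.update_self, Finset.insert_erase hi]
        congr 1
        exact Multiset.map_congr rfl fun j hj =>
          Function.update_of_ne (Finset.ne_of_mem_erase (Finset.mem_def.2 hj)) _ _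
      rw [hmap, hmap, hm, Multiset.cons_swap]

/-- A path from `0` back to `0` has equal endpoints; cancelling them leaves the same multiset of
values for `b` and `b'`, hence equal laws under uniform weights. -/
theorem Fintype.exists_sub_eq_of_sum_eq_zero {ι : Type*} [Fintype ι] {a : ι → ℝ} {l u : ℝ}
    (ha : ∀ i, a i ∈ Set.Icc l u) (h0 : (0 : ℝ) ∈ Set.Icc l u) (hsum : ∑ i, a i = 0) :
    ∃ b b' : ι → ℝ, (∀ i, b i - b' i = a i ∧ b i ∈ Set.Icc l u ∧ b' i ∈ Set.Icc l u) ∧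
      ∀ h : ℝ → ℝ≥0∞, ∑ i, h (b i) = ∑ i, h (b' i) := by
  classical
  obtain ⟨b, b', hb, hm⟩ := Finset.exists_partial_sums_mem_Icc Finset.univ
    (fun i _ => ha i) h0 (by rw [hsum, add_zero])
  refine ⟨b, b', fun i => hb i (Finset.mem_univ i), fun h => ?_⟩
  have hm' := congrArg (fun m => (m.map h).sum) ((Multiset.cons_inj_right _).1 hm)
  simp only [Multiset.map_map, Function.comp_def] at hm'
  exact hm'

/-- This makes measurable real functions constant on cells, so that everything reduces to functions
on `Fin n`. -/
theorem mem_iff_mem_of_measurableSet_generateFrom_partition {S : Type*} {π : Set (Set S)}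
    (hπ : Setoid.IsPartition π) {A : Set S}
    (hA : MeasurableSet[MeasurableSpace.generateFrom π] A) {E : Set S} (hE : E ∈ π) {s t : S}
    (hs : s ∈ E) (ht : t ∈ E) : s ∈ A ↔ t ∈ A := by
  induction A, hA using MeasurableSpace.generateFrom_induction with
  | hC A hA _ =>
    have key : ∀ {r}, r ∈ E → r ∈ A → A = E := fun hrE hrA =>
      hπ.pairwiseDisjoint.elim_set hA hE _ hrA hrE
    exact ⟨fun h => key hs h ▸ ht, fun h => key ht h ▸ hs⟩
  | empty => simp
  | compl A _ ih => simp [ih]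
  | iUnion A _ ih => simp [ih]

theorem IsFiniteUniform.exists_measurable_cell {S : Type*} [MeasurableSpace S] {P : Measure S}
    [IsProbabilityMeasure P] (hP : IsFiniteUniform P) :
    ∃ (n : ℕ) (_ : n ≠ 0) (cell : S → Fin n), Measurable cell ∧
      (∀ i, P (cell ⁻¹' {i}) = (n : ℝ≥0∞)⁻¹) ∧
      ∀ f : S → ℝ, Measurable f → ∃ a : Fin n → ℝ, f = a ∘ cell := by
  obtain ⟨π, hfin, hπ, hgen, hunif⟩ := hP
  have : Finite π := hfin
  let e : π ≃ Fin π.ncard := Finite.equivFinOfCardEq (Nat.card_coe_set_eq π)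
  choose C hC hCuniq using hπ.2
  let cell : S → Fin π.ncard := fun s => e ⟨C s, (hC s).1⟩
  have hpre : ∀ i, cell ⁻¹' {i} = (e.symm i : Set S) := by
    intro i
    ext s
    simp only [cell, Set.mem_preimage, Set.mem_singleton_iff, ← Equiv.eq_symm_apply,
      Subtype.ext_iff]
    exact ⟨fun h => h ▸ (hC s).2, fun h => (hCuniq s _ ⟨(e.symm i).2, h⟩).symm⟩
  have hne : Nonempty S := (nonempty_of_measure_ne_zero (μ := P) (s := Set.univ) (by simp)).to_type
  have hn : π.ncard ≠ 0 := (cell hne.some).pos.ne'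
  have hnonempty : ∀ i, (cell ⁻¹' {i}).Nonempty := fun i => by
    rw [hpre, Set.nonempty_iff_ne_empty]
    exact fun h => hπ.1 (h ▸ (e.symm i).2)
  refine ⟨π.ncard, hn, cell, measurable_to_countable' fun i => ?_, fun i => ?_, fun f hf => ?_⟩
  · rw [hpre, hgen]
    exact MeasurableSpace.measurableSet_generateFrom (e.symm i).2
  · rw [hpre]
    exact hunif _ (e.symm i).2
  · choose r hr using hnonempty
    refine ⟨fun i => f (r i), funext fun s => ?_⟩
    have hmem (i) {t : S} (ht : cell t = i) : t ∈ (e.symm i : Set S) := by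
      rw [← hpre]
      exact ht
    have hA : MeasurableSet (f ⁻¹' {f s}) := hf (measurableSet_singleton _)
    rw [hgen] at hA
    exact ((mem_iff_mem_of_measurableSet_generateFrom_partition hπ hA (e.symm (cell s)).2
      (hmem _ rfl) (hmem _ (hr (cell s)))).1 rfl).symm

theorem IsFiniteUniform.exists_sub_eq {S : Type*} [MeasurableSpace S] {P : Measure S}
    [IsProbabilityMeasure P] (hP : IsFiniteUniform P) {f : S → ℝ} (hf : Measurable f)
    (hmean : ∫ s, f s ∂P = 0) :
    ∃ g ∈ randomLp ∞ P, ∃ g' ∈ randomLp ∞ P, IdentDistrib g g' P P ∧ g - g' = f ∧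
      (∀ᵐ s ∂P, essInf f P ≤ g s ∧ g s ≤ essSup f P) ∧
      (∀ᵐ s ∂P, essInf f P ≤ g' s ∧ g' s ≤ essSup f P) := by
  obtain ⟨n, hn, cell, hcell, hunif, hfac⟩ := hP.exists_measurable_cell
  obtain ⟨a, rfl⟩ := hfac f hf
  have hbound (b : Fin n → ℝ) (s : S) : |b (cell s)| ≤ ∑ i, |b i| :=
    Finset.single_le_sum (f := fun i => |b i|) (fun i _ => abs_nonneg _) (Finset.mem_univ _)
  have hlaw (i : Fin n) : P.map cell {i} = (n : ℝ≥0∞)⁻¹ := by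
    rw [Measure.map_apply hcell (measurableSet_singleton i), hunif]
  have hsum : ∑ i, a i = 0 := by
    have h := integral_map (f := a) hcell.aemeasurable (μ := P) (by fun_prop)
    have : IsProbabilityMeasure (P.map cell) := Measure.isProbabilityMeasure_map hcell.aemeasurable
    rw [integral_fintype .of_finite] at h
    simp only [measureReal_def, hlaw, ENNReal.toReal_inv, ENNReal.toReal_natCast, smul_eq_mul,
      ← Finset.mul_sum] at h
    rw [show ∫ s, a (cell s) ∂P = 0 from hmean] at h
    exact (mul_eq_zero.1 h).resolve_left (by simpa using hn)
  -- Every cell has positive probability, so what holds almost surely holds on each cell.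
  have hatom {p : Fin n → Prop} (hp : ∀ᵐ s ∂P, p (cell s)) (i : Fin n) : p i := by
    by_contra hpi
    have h0 : P (cell ⁻¹' {i}) = 0 := by
      refine measure_mono_null (fun s hs => ?_) hp
      have hs' : cell s = i := hs
      simpa [hs'] using hpi
    rw [hunif] at h0
    simp at h0
  have hbdd : ∀ᵐ s ∂P, |(a ∘ cell) s| ≤ ∑ i, |a i| := ae_of_all _ (hbound a)
  have hge : ∀ᵐ s ∂P, essInf (a ∘ cell) P ≤ a (cell s) := ae_essInf_le
    ⟨_, Filter.eventually_map.2 (hbdd.mono fun s hs => (abs_le.1 hs).1)⟩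
  have hle : ∀ᵐ s ∂P, a (cell s) ≤ essSup (a ∘ cell) P := ae_le_essSup
    ⟨_, Filter.eventually_map.2 (hbdd.mono fun s hs => (abs_le.1 hs).2)⟩
  set l := essInf (a ∘ cell) P
  set u := essSup (a ∘ cell) P
  have ha : ∀ i, a i ∈ Set.Icc l u := fun i => ⟨hatom (p := fun i => l ≤ a i) hge i,
    hatom (p := fun i => a i ≤ u) hle i⟩
  have hne : (Finset.univ : Finset (Fin n)).Nonempty :=
    Finset.univ_nonempty_iff.2 (Fin.pos_iff_nonempty.1 (Nat.pos_of_ne_zero hn))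
  have h0 : (0 : ℝ) ∈ Set.Icc l u := by
    obtain ⟨i, -, hi⟩ := Finset.exists_le_of_sum_le (f := a) (g := fun _ => (0 : ℝ)) hne
      (by rw [hsum, Finset.sum_const_zero])
    obtain ⟨j, -, hj⟩ := Finset.exists_le_of_sum_le (f := fun _ => (0 : ℝ)) (g := a) hne
      (by rw [hsum, Finset.sum_const_zero])
    exact ⟨(ha i).1.trans hi, hj.trans (ha j).2⟩
  obtain ⟨b, b', hb, hbb'⟩ := Fintype.exists_sub_eq_of_sum_eq_zero ha h0 hsum
  have hmeas (b : Fin n → ℝ) : Measurable (b ∘ cell) := (measurable_of_finite b).comp hcell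
  have hmem (b : Fin n → ℝ) : b ∘ cell ∈ randomLp ∞ P :=
    ⟨hmeas b, memLp_top_of_bound (hmeas b).aestronglyMeasurable _ (ae_of_all _ (hbound b))⟩
  refine ⟨b ∘ cell, hmem b, b' ∘ cell, hmem b', ⟨(hmeas b).aemeasurable, (hmeas b').aemeasurable,
    Measure.ext_of_lintegral _ fun h hh => ?_⟩, funext fun s => (hb (cell s)).1,
    ae_of_all _ fun s => (hb (cell s)).2.1, ae_of_all _ fun s => (hb (cell s)).2.2⟩
  have hint (b : Fin n → ℝ) : ∫⁻ x, h x ∂P.map (b ∘ cell) = (∑ i, h (b i)) * (n : ℝ≥0∞)⁻¹ := by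
    rw [← Measure.map_map (measurable_of_finite b) hcell, lintegral_map hh (measurable_of_finite b),
      lintegral_fintype, Finset.sum_mul]
    simp only [hlaw]
  rw [hint, hint, hbb']

/-! ### Necessity of mean zero -/

theorem ProbabilityTheory.IdentDistrib.integral_sub_eq_zero {S : Type*} [MeasurableSpace S]
    {P : Measure S} [IsProbabilityMeasure P] {g g' : S → ℝ} (h : IdentDistrib g g' P P)
    (hint : Integrable (g - g') P) : ∫ s, (g - g') s ∂P = 0 := by
  let T : ℕ → ℝ → ℝ := fun n x => max (-n) (min n x)
  have hT (n) : Measurable (T n) := by fun_prop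
  have hTb (n x) : |T n x| ≤ n := by
    have hn : (0 : ℝ) ≤ n := n.cast_nonneg
    rw [abs_le]
    exact ⟨le_max_left _ _, max_le (by linarith) (min_le_left _ _)⟩
  have hTint (n) {k : S → ℝ} (hk : AEMeasurable k P) : Integrable (fun s => T n (k s)) P :=
    .of_bound ((hT n).comp_aemeasurable hk).aestronglyMeasurable n (ae_of_all _ fun s => hTb n _)
  -- Clamping is 1-Lipschitz, so `|g - g'|` dominates the truncated differences although `g` and
  -- `g'` need not be integrable.
  have hlip (n x y) : |T n x - T n y| ≤ |x - y| :=
    (abs_max_sub_max_le_max _ _ _ _).trans (max_le (by simp) ((abs_min_sub_min_le_max _ _ _ _).trans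
      (max_le (by simp) le_rfl)))
  have hlim (x : ℝ) : Filter.Tendsto (fun n => T n x) Filter.atTop (nhds x) := by
    obtain ⟨N, hN⟩ := exists_nat_ge |x|
    refine tendsto_const_nhds.congr' ?_
    filter_upwards [Filter.eventually_ge_atTop N] with n hn
    have hn' : |x| ≤ n := hN.trans (by exact_mod_cast hn)
    simp only [T]
    rw [min_eq_right (abs_le.1 hn').2, max_eq_right (abs_le.1 hn').1]
  have hzero (n) : ∫ s, (T n (g s) - T n (g' s)) ∂P = 0 := by
    rw [integral_sub (hTint n h.aemeasurable_fst) (hTint n h.aemeasurable_snd), sub_eq_zero]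
    exact (h.comp (hT n)).integral_eq
  have hconv := tendsto_integral_of_dominated_convergence
    (F := fun n s => T n (g s) - T n (g' s)) (f := g - g') (fun s => |(g - g') s|)
    (fun n => ((hTint n h.aemeasurable_fst).sub (hTint n h.aemeasurable_snd)).1) hint.abs
    (fun n => ae_of_all _ fun s => hlip n _ _)
    (ae_of_all _ fun s => (hlim (g s)).sub (hlim (g' s)))
  simp only [hzero] at hconv
  exact tendsto_nhds_unique hconv tendsto_const_nhds

theorem integral_eq_zero_of_identDistrib_sub {S : Type*} [MeasurableSpace S] {P : Measure S}
    [IsProbabilityMeasure P] {f g g' : S → ℝ} (hf : Integrable f P) (h : IdentDistrib g g' P P)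
    (hsub : IdentDistrib (g - g') f P P) : ∫ s, f s ∂P = 0 := by
  rw [← hsub.integral_eq]
  exact h.integral_sub_eq_zero (hsub.integrable_iff.2 hf)

/-! ### Assembly over the function spaces -/

theorem MeasureTheory.MemLp.ae_essInf_le_and_le_essSup {S : Type*} [MeasurableSpace S]
    {P : Measure S} {f : S → ℝ} (hf : MemLp f ∞ P) :
    ∀ᵐ s ∂P, essInf f P ≤ f s ∧ f s ≤ essSup f P := by
  have hM : ∀ᵐ s ∂P, |f s| ≤ (eLpNormEssSup f P).toReal := by
    filter_upwards [ae_le_eLpNormEssSup (f := f) (μ := P)] with s hs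
    rw [← Real.norm_eq_abs, ← toReal_enorm]
    exact ENNReal.toReal_mono (by simpa using hf.2.ne) hs
  have hge : ∀ᵐ s ∂P, essInf f P ≤ f s := ae_essInf_le
    ⟨_, Filter.eventually_map.2 (hM.mono fun s hs => (abs_le.1 hs).1)⟩
  have hle : ∀ᵐ s ∂P, f s ≤ essSup f P := ae_le_essSup
    ⟨_, Filter.eventually_map.2 (hM.mono fun s hs => (abs_le.1 hs).2)⟩
  exact hge.and hle

theorem randomMInf_iff {S : Type*} [MeasurableSpace S] {P : Measure S} {f : S → ℝ} :
    f ∈ randomMInf P ↔ ∀ p : ℕ, Measurable f ∧ MemLp f p P := by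
  simp [randomMInf, randomLp]

/-- On an adequate probability space, one pair serves all the spaces `L^k`, `L^∞` and `M^∞` to
which a centred random variable belongs. -/
theorem IsAdequate.exists_identDistrib_sub {S : Type*} [MeasurableSpace S] {P : Measure S}
    [IsProbabilityMeasure P] (hP : IsAdequate P) {f : S → ℝ} (hf : Measurable f)
    (hint : Integrable f P) (hmean : ∫ s, f s ∂P = 0) :
    ∃ g g' : S → ℝ, Measurable g ∧ Measurable g' ∧ IdentDistrib g g' P P ∧
      IdentDistrib (g - g') f P P ∧
      (∀ k : ℝ, 1 ≤ k → MemLp f (ENNReal.ofReal k) P → MemLp g (ENNReal.ofReal (k - 1)) P) ∧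
      (MemLp f ∞ P → ∀ᵐ s ∂P, essInf f P ≤ g s ∧ g s ≤ essSup f P) := by
  rcases hP with hP | hP
  · obtain ⟨g, g', hg, hg', hgg', hsub, hLp, hbd⟩ := hP.exists_identDistrib_sub hf hint hmean
    exact ⟨g, g', hg, hg', hgg', hsub, hLp, fun h => hbd _ _ h.ae_essInf_le_and_le_essSup⟩
  · obtain ⟨g, hg, g', hg', hgg', hsub, hbd, -⟩ := hP.exists_sub_eq hf hmean
    exact ⟨g, g', hg.1, hg'.1, hgg', by rw [hsub]; exact .refl hf.aemeasurable,
      fun k _ _ => hg.2.mono_exponent le_top, fun _ => hbd⟩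

theorem IsAdequate.exists_mem_randomLp {S : Type*} [MeasurableSpace S] {P : Measure S}
    [IsProbabilityMeasure P] (hP : IsAdequate P) {k : ℝ} (hk : 1 ≤ k) {f : S → ℝ}
    (hf : f ∈ randomLp (ENNReal.ofReal k) P) (hmean : ∫ s, f s ∂P = 0) :
    ∃ g ∈ randomLp (ENNReal.ofReal (k - 1)) P, ∃ g' ∈ randomLp (ENNReal.ofReal (k - 1)) P,
      IdentDistrib g g' P P ∧ IdentDistrib (g - g') f P P := by
  obtain ⟨g, g', hg, hg', hgg', hsub, hLp, -⟩ := hP.exists_identDistrib_sub hf.1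
    (hf.2.integrable (by simpa using hk)) hmean
  have h := hLp k hk hf.2
  exact ⟨g, ⟨hg, h⟩, g', ⟨hg', hgg'.memLp_snd h⟩, hgg', hsub⟩

theorem IsAdequate.exists_mem_randomLp_top {S : Type*} [MeasurableSpace S] {P : Measure S}
    [IsProbabilityMeasure P] (hP : IsAdequate P) {f : S → ℝ} (hf : f ∈ randomLp ∞ P)
    (hmean : ∫ s, f s ∂P = 0) :
    ∃ g ∈ randomLp ∞ P, ∃ g' ∈ randomLp ∞ P,
      IdentDistrib g g' P P ∧ IdentDistrib (g - g') f P P ∧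
      (∀ᵐ s ∂P, essInf f P ≤ g s ∧ g s ≤ essSup f P) ∧
      (∀ᵐ s ∂P, essInf f P ≤ g' s ∧ g' s ≤ essSup f P) := by
  obtain ⟨g, g', hg, hg', hgg', hsub, -, hbd⟩ := hP.exists_identDistrib_sub hf.1
    (hf.2.integrable le_top) hmean
  have h := hbd hf.2
  have hmem : MemLp g ∞ P := memLp_of_bounded h hg.aestronglyMeasurable ∞
  exact ⟨g, ⟨hg, hmem⟩, g', ⟨hg', hgg'.memLp_snd hmem⟩, hgg', hsub, h,
    hgg'.ae_mem_snd measurableSet_Icc h⟩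

theorem IsAdequate.exists_mem_randomMInf {S : Type*} [MeasurableSpace S] {P : Measure S}
    [IsProbabilityMeasure P] (hP : IsAdequate P) {f : S → ℝ} (hf : f ∈ randomMInf P)
    (hmean : ∫ s, f s ∂P = 0) :
    ∃ g ∈ randomMInf P, ∃ g' ∈ randomMInf P,
      IdentDistrib g g' P P ∧ IdentDistrib (g - g') f P P := by
  rw [randomMInf_iff] at hf
  obtain ⟨g, g', hg, hg', hgg', hsub, hLp, -⟩ := hP.exists_identDistrib_sub (hf 1).1
    ((hf 1).2.integrable (by simp)) hmean
  have h (p : ℕ) : MemLp g p P := by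
    -- All moments of `f` are finite, so the lost moment is absorbed by taking `k = p + 1`.
    have := hLp (p + 1) (by simp) (by
      have := (hf (p + 1)).2
      rwa [← Nat.cast_add_one, ENNReal.ofReal_natCast])
    rwa [add_sub_cancel_right, ENNReal.ofReal_natCast] at this
  exact ⟨g, randomMInf_iff.2 fun p => ⟨hg, h p⟩, g',
    randomMInf_iff.2 fun p => ⟨hg', hgg'.memLp_snd (h p)⟩, hgg', hsub⟩

theorem mainTheorem5 {S : Type*} [MeasurableSpace S] (P : Measure S) [IsProbabilityMeasure P]
    (hP : IsAdequate P) :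
    -- the characterization in `L^k`, for real `k ≥ 1`
    (∀ k : ℝ, 1 ≤ k → ∀ f ∈ randomLp (ENNReal.ofReal k) P,
      (∫ s, f s ∂P = 0 ↔
        ∃ g ∈ randomLp (ENNReal.ofReal (k - 1)) P, ∃ g' ∈ randomLp (ENNReal.ofReal (k - 1)) P,
          IdentDistrib g g' P P ∧ IdentDistrib (g - g') f P P)) ∧
    -- the characterization in `L^∞`
    (∀ f ∈ randomLp ∞ P,
      (∫ s, f s ∂P = 0 ↔
        ∃ g ∈ randomLp ∞ P, ∃ g' ∈ randomLp ∞ P,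
          IdentDistrib g g' P P ∧ IdentDistrib (g - g') f P P)) ∧
    -- in `L^∞`, the pair can be chosen between the essential bounds of `f`
    (∀ f ∈ randomLp ∞ P, ∫ s, f s ∂P = 0 →
        ∃ g ∈ randomLp ∞ P, ∃ g' ∈ randomLp ∞ P,
          IdentDistrib g g' P P ∧ IdentDistrib (g - g') f P P ∧
          (∀ᵐ s ∂P, essInf f P ≤ g s ∧ g s ≤ essSup f P) ∧
          (∀ᵐ s ∂P, essInf f P ≤ g' s ∧ g' s ≤ essSup f P)) ∧
    -- the characterization in `M^∞`
    (∀ f ∈ randomMInf P,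
      (∫ s, f s ∂P = 0 ↔
        ∃ g ∈ randomMInf P, ∃ g' ∈ randomMInf P,
          IdentDistrib g g' P P ∧ IdentDistrib (g - g') f P P)) ∧
    -- on finite uniform spaces, the difference can be exactly `f`, with the same bounds
    (IsFiniteUniform P → ∀ f : S → ℝ, Measurable f → ∫ s, f s ∂P = 0 →
        ∃ g ∈ randomLp ∞ P, ∃ g' ∈ randomLp ∞ P,
          IdentDistrib g g' P P ∧ g - g' = f ∧
          (∀ᵐ s ∂P, essInf f P ≤ g s ∧ g s ≤ essSup f P) ∧
          (∀ᵐ s ∂P, essInf f P ≤ g' s ∧ g' s ≤ essSup f P)) := by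
  refine ⟨fun k hk f hf => ⟨hP.exists_mem_randomLp hk hf, ?_⟩, fun f hf => ⟨fun h0 => ?_, ?_⟩,
    fun f hf => hP.exists_mem_randomLp_top hf,
    fun f hf => ⟨hP.exists_mem_randomMInf hf, ?_⟩, fun hU f hf => hU.exists_sub_eq hf⟩
  · rintro ⟨g, -, g', -, hgg', hsub⟩
    exact integral_eq_zero_of_identDistrib_sub (hf.2.integrable (by simpa using hk)) hgg' hsub
  · obtain ⟨g, hg, g', hg', hgg', hsub, -⟩ := hP.exists_mem_randomLp_top hf h0
    exact ⟨g, hg, g', hg', hgg', hsub⟩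
  · rintro ⟨g, -, g', -, hgg', hsub⟩
    exact integral_eq_zero_of_identDistrib_sub (hf.2.integrable le_top) hgg' hsub
  · rintro ⟨g, -, g', -, hgg', hsub⟩
    exact integral_eq_zero_of_identDistrib_sub ((randomMInf_iff.1 hf 1).2.integrable (by simp))
      hgg' hsub
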